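/- Let $d\ge 1$ be fixed and let $\rho$ be any probability distribution on the unit sphere $\mathcal S^{d-1}\subset\mathbb R^d$. For each $n\ge 1$ let $m=m(n)\ge 1$ be a network width, let $\nu=\nu(n)\in(0,1]$, and let $x_1,\dots,x_n\sim\rho$, $w_1,\dots,w_m\sim\mathcal N(0,\nu^2 I_d)$ and $a_1,\dots,a_m$ uniform on $\{-1,1\}$ all be independent (i.i.d. data and random initialization of a two-layer ReLU network with output weights $a_j$). Let $H=H^++H^-$ be the random symmetric $n\times n$ matrix with $$H^{\pm}_{ii'}=\frac{1}{nm}\langle x_i,x_{i'}\rangle\sum_{j:\,a_j=\pm1}\mathbf 1\{\langle w_j,x_i\rangle>0\}\,\mathbf 1\{\langle w_j,x_{i'}\rangle>0\},$$ and let $\lambda_{\min}(H)$ be its smallest eigenvalue. Then for any stepsizes $\eta=\eta(n)>0$ with $\eta=O(1)$, the convergence rate $\log\frac{1}{1-\eta\lambda_{\min}(H)}$ tends to $0$ in probability as $n\to\infty$; that is, $\Pr[1-\eta\lambda_{\min}(H)>0]\to 1$ (so the rate is well defined with probability tending to one), and for every $\varepsilon>0$, $\Pr\left[\left|\log\frac{1}{1-\eta\lambda_{\min}(H)}\right|\ge\varepsilon\right]\to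 0$. -/

import Mathlib

open MeasureTheory ProbabilityTheory Filter Topology

namespace ReluNet

/-- The ambient Euclidean space `ℝ^d`. -/
abbrev Vec (d : ℕ) : Type := EuclideanSpace ℝ (Fin d)

/-- The unit sphere `S^{d-1}` of `ℝ^d`. -/
abbrev Sphere (d : ℕ) : Type := Metric.sphere (0 : Vec d) 1

/-- The activation indicator `1{⟨w, x⟩ > 0}` of a ReLU neuron with weight `w` at the feature `x`. -/
noncomputable def active {d : ℕ} (w x : Vec d) : ℝ :=
  if 0 < inner ℝ w x then 1 else 0

/-- The `n × n` matrix with entries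
`(1 / (n m)) ⟨x_i, x_k⟩ ∑_{j : a_j = s} 1{⟨w_j, x_k⟩ > 0} 1{⟨w_j, x_i⟩ > 0}`:
the contribution of the hidden neurons whose output weight is `s`. -/
noncomputable def signKernel (s : ℝ) {d n m : ℕ} (x : Fin n → Sphere d) (w : Fin m → Vec d)
    (a : Fin m → ℝ) : Matrix (Fin n) (Fin n) ℝ :=
  Matrix.of fun i k => 1 / ((n : ℝ) * (m : ℝ)) * inner ℝ (x i : Vec d) (x k : Vec d) *
    ∑ j ∈ Finset.univ.filter (fun j => a j = s),
      active (w j) (x k : Vec d) * active (w j) (x i : Vec d)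

/-- `H = H⁺ + H⁻`, the sum of the contributions of the neurons with output weight `+1` and of those
with output weight `-1`, evaluated at the first-layer weights `w`. -/
noncomputable def kernelMatrix {d n m : ℕ} (x : Fin n → Sphere d) (w : Fin m → Vec d)
    (a : Fin m → ℝ) : Matrix (Fin n) (Fin n) ℝ :=
  signKernel 1 x w a + signKernel (-1) x w a

/-- The smallest eigenvalue of a real square matrix. -/
noncomputable def minEigenvalue {n : ℕ} (A : Matrix (Fin n) (Fin n) ℝ) : ℝ :=
  sInf (spectrum ℝ A)

/-- For a nonempty symmetric real matrix, `minEigenvalue` is attained and is the least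
eigenvalue. -/
theorem isLeast_minEigenvalue {n : ℕ} (hn : 0 < n) {A : Matrix (Fin n) (Fin n) ℝ}
    (hA : A.IsHermitian) : IsLeast (spectrum ℝ A) (minEigenvalue A) := by
  have hfin : (spectrum ℝ A).Finite := Matrix.finite_real_spectrum
  have hne : (spectrum ℝ A).Nonempty := ⟨_, hA.eigenvalues_mem_spectrum_real ⟨0, hn⟩⟩
  exact ⟨hne.csInf_mem hfin, fun _ h => csInf_le hfin.bddBelow h⟩

/-- `H` is symmetric. -/
theorem kernelMatrix_isHermitian {d n m : ℕ} (x : Fin n → Sphere d) (w : Fin m → Vec d)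
    (a : Fin m → ℝ) : (kernelMatrix x w a).IsHermitian := by
  refine Matrix.IsHermitian.ext fun i k => ?_
  simp only [kernelMatrix, signKernel, Matrix.add_apply, Matrix.of_apply, star_trivial,
    real_inner_comm (x i : Vec d) (x k : Vec d),
    mul_comm (active _ (x i : Vec d)) (active _ (x k : Vec d))]

/-- The convergence rate `log (1 / (1 - η λ_min(H)))` of gradient descent with stepsize `η`. -/
noncomputable def convergenceRate (eta : ℝ) {d n m : ℕ} (x : Fin n → Sphere d)
    (w : Fin m → Vec d) (a : Fin m → ℝ) : ℝ :=
  Real.log (1 / (1 - eta * minEigenvalue (kernelMatrix x w a)))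

/-- The uniform law on `{1, -1}`. -/
noncomputable def signLaw : Measure ℝ :=
  (2⁻¹ : ENNReal) • Measure.dirac 1 + (2⁻¹ : ENNReal) • Measure.dirac (-1)

instance : IsProbabilityMeasure signLaw :=
  ⟨by simp [signLaw, ENNReal.inv_two_add_inv_two]⟩

/-- A dataset of `n` features, `m` first-layer weights, and `m` output weights. -/
abbrev Sample (d n m : ℕ) : Type :=
  (Fin n → Sphere d) × (Fin m → Vec d) × (Fin m → ℝ)

/-- The joint law of the features and of the random initialization: `n` features with law `ρ`,
`m` first-layer weights with law `N(0, ν² I)` and `m` uniform signs, all independent. -/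
noncomputable def sampleLaw {d : ℕ} (ρ : Measure (Sphere d)) (n m : ℕ) (nu : ℝ) :
    Measure (Sample d n m) :=
  (Measure.pi fun _ : Fin n => ρ).prod
    ((Measure.pi fun _ : Fin m =>
        multivariateGaussian (0 : Vec d) (nu ^ 2 • (1 : Matrix (Fin d) (Fin d) ℝ))).prod
      (Measure.pi fun _ : Fin m => signLaw))

instance {d : ℕ} (ρ : Measure (Sphere d)) [IsProbabilityMeasure ρ] (n m : ℕ) (nu : ℝ) :
    IsProbabilityMeasure (sampleLaw ρ n m nu) := by
  unfold sampleLaw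
  infer_instance

end ReluNet

/-! The convergence is deterministic and uniform over all samples. `H` is a nonnegative combination of
Gram matrices of the gated features `1{⟨w_j, x_i⟩ > 0} x_i`, hence positive semidefinite
(`kernelMatrix_posSemidef`). The features have unit norm and every neuron has at most one of the
signs `1`, `-1`, so each diagonal entry of `H` is at most `1 / n` and the trace is at most `1`
(`trace_kernelMatrix_le_one`). The smallest of the `n` eigenvalues is at most their mean, so
`0 ≤ λ_min(H) ≤ 1 / n` for every sample. With bounded stepsizes, `η λ_min(H)` tends to `0` uniformly
(`eventually_forall_eta_mul_minEigenvalue_lt`), and `t ↦ log (1 / (1 - t))` is continuous and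
vanishes at `0`. The two events therefore eventually have probability exactly `1` and `0`. -/

namespace ReluNet

/-- The signed kernel is a nonnegative multiple of a sum over neurons of Gram matrices of the gated
features. -/
theorem signKernel_eq_smul_sum_gram (s : ℝ) {d n m : ℕ} (x : Fin n → Sphere d) (w : Fin m → Vec d)
    (a : Fin m → ℝ) :
    signKernel s x w a = (1 / ((n : ℝ) * (m : ℝ))) •
      ∑ j ∈ Finset.univ.filter (fun j => a j = s),
        Matrix.gram ℝ (fun i => active (w j) (x i : Vec d) • (x i : Vec d)) := by
  ext i k
  simp only [signKernel, Matrix.of_apply, Matrix.smul_apply, Matrix.sum_apply, Matrix.gram_apply,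
    real_inner_smul_left, real_inner_smul_right, smul_eq_mul, mul_assoc, Finset.mul_sum]
  exact Finset.sum_congr rfl fun j _ => by ring

theorem signKernel_posSemidef (s : ℝ) {d n m : ℕ} (x : Fin n → Sphere d) (w : Fin m → Vec d)
    (a : Fin m → ℝ) : (signKernel s x w a).PosSemidef := by
  rw [signKernel_eq_smul_sum_gram]
  exact (Matrix.posSemidef_sum _ fun j _ => Matrix.posSemidef_gram ℝ _).smul (by positivity)

theorem kernelMatrix_posSemidef {d n m : ℕ} (x : Fin n → Sphere d) (w : Fin m → Vec d)
    (a : Fin m → ℝ) : (kernelMatrix x w a).PosSemidef :=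
  (signKernel_posSemidef 1 x w a).add (signKernel_posSemidef (-1) x w a)

theorem signKernel_diag_le (s : ℝ) {d n m : ℕ} (x : Fin n → Sphere d) (w : Fin m → Vec d)
    (a : Fin m → ℝ) (i : Fin n) :
    signKernel s x w a i i ≤
      1 / ((n : ℝ) * (m : ℝ)) * ((Finset.univ.filter (fun j => a j = s)).card : ℝ) := by
  have hx : inner ℝ (x i : Vec d) (x i : Vec d) = 1 := by
    rw [real_inner_self_eq_norm_sq, norm_eq_of_mem_sphere, one_pow]
  rw [signKernel, Matrix.of_apply, hx, mul_one]
  gcongr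
  refine (Finset.sum_le_card_nsmul _ _ 1 fun j _ => ?_).trans_eq (by simp)
  unfold active
  split_ifs <;> norm_num

theorem kernelMatrix_diag_le {d n m : ℕ} (x : Fin n → Sphere d) (w : Fin m → Vec d)
    (a : Fin m → ℝ) (i : Fin n) : kernelMatrix x w a i i ≤ 1 / (n : ℝ) := by
  have hdisj : Disjoint (Finset.univ.filter fun j => a j = 1)
      (Finset.univ.filter fun j => a j = -1) :=
    Finset.disjoint_filter.2 fun j _ h1 h2 => by linarith
  have hcard : ((Finset.univ.filter fun j => a j = 1).card : ℝ) +
      (Finset.univ.filter fun j => a j = -1).card ≤ m := by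
    rw [← Nat.cast_add, ← Finset.card_union_of_disjoint hdisj]
    exact_mod_cast (Finset.card_le_univ _).trans_eq (Fintype.card_fin m)
  calc kernelMatrix x w a i i
      ≤ 1 / ((n : ℝ) * m) * (((Finset.univ.filter fun j => a j = 1).card : ℝ) +
          (Finset.univ.filter fun j => a j = -1).card) := by
        rw [mul_add]
        exact add_le_add (signKernel_diag_le 1 x w a i) (signKernel_diag_le (-1) x w a i)
    _ ≤ 1 / ((n : ℝ) * m) * m := by gcongr
    _ = 1 / (n : ℝ) * (m / m) := by ring
    _ ≤ 1 / (n : ℝ) := mul_le_of_le_one_right (by positivity) (div_self_le_one _)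

theorem trace_kernelMatrix_le_one {d n m : ℕ} (x : Fin n → Sphere d) (w : Fin m → Vec d)
    (a : Fin m → ℝ) : (kernelMatrix x w a).trace ≤ 1 := by
  calc (kernelMatrix x w a).trace
      ≤ ∑ _i : Fin n, 1 / (n : ℝ) := Finset.sum_le_sum fun i _ => kernelMatrix_diag_le x w a i
    _ = n / n := by simp [div_eq_mul_inv]
    _ ≤ 1 := div_self_le_one _

/-- The smallest eigenvalue is at most the mean of the eigenvalues. -/
theorem card_mul_minEigenvalue_le_trace {n : ℕ} {A : Matrix (Fin n) (Fin n) ℝ}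
    (hA : A.IsHermitian) : (n : ℝ) * minEigenvalue A ≤ A.trace := by
  rw [hA.trace_eq_sum_eigenvalues]
  calc (n : ℝ) * minEigenvalue A = ∑ _i : Fin n, minEigenvalue A := by simp
    _ ≤ _ := Finset.sum_le_sum fun i _ =>
      (isLeast_minEigenvalue i.pos hA).2 (hA.eigenvalues_mem_spectrum_real i)

theorem minEigenvalue_nonneg {n : ℕ} {A : Matrix (Fin n) (Fin n) ℝ} (hA : A.PosSemidef) :
    0 ≤ minEigenvalue A := by
  refine Real.sInf_nonneg fun r hr => ?_
  rw [hA.isHermitian.spectrum_real_eq_range_eigenvalues] at hr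
  obtain ⟨i, rfl⟩ := hr
  exact hA.eigenvalues_nonneg i

theorem minEigenvalue_kernelMatrix_le {d n m : ℕ} (hn : 0 < n) (x : Fin n → Sphere d)
    (w : Fin m → Vec d) (a : Fin m → ℝ) : minEigenvalue (kernelMatrix x w a) ≤ 1 / (n : ℝ) := by
  rw [le_div_iff₀' (by exact_mod_cast hn)]
  exact (card_mul_minEigenvalue_le_trace (kernelMatrix_isHermitian x w a)).trans
    (trace_kernelMatrix_le_one x w a)

/-- Bounded stepsizes make `η λ_min(H)` small, uniformly over the samples. -/
theorem eventually_forall_eta_mul_minEigenvalue_lt {eta : ℕ → ℝ} (heta_pos : ∀ n, 0 < eta n)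
    (heta : eta =O[atTop] (fun _ => (1 : ℝ))) (d : ℕ) (m : ℕ → ℕ) {δ : ℝ} (hδ : 0 < δ) :
    ∀ᶠ n in atTop, ∀ z : Sample d n (m n),
      eta n * minEigenvalue (kernelMatrix z.1 z.2.1 z.2.2) < δ := by
  have hlim : Tendsto (fun n : ℕ => eta n * (1 / (n : ℝ))) atTop (𝓝 0) := by
    have h := heta.mul_isLittleO
      ((Asymptotics.isLittleO_one_iff ℝ).2 tendsto_one_div_atTop_nhds_zero_nat)
    simp only [mul_one] at h
    exact (Asymptotics.isLittleO_one_iff ℝ).1 h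
  filter_upwards [hlim.eventually_lt_const hδ, eventually_gt_atTop 0] with n hn hpos z
  exact (mul_le_mul_of_nonneg_left (minEigenvalue_kernelMatrix_le hpos _ _ _)
    (heta_pos n).le).trans_lt hn

end ReluNet

/-- For every data distribution on the sphere, all positive widths `m n`, all initialization scales
`ν n ∈ (0, 1]` and every bounded sequence of positive stepsizes `η n`, the rate
`log (1 / (1 - η λ_min(H)))` is well defined with probability tending to one, and it converges to
zero in probability as `n → ∞`. -/
theorem corollary1 (d : ℕ) (ρ : Measure (ReluNet.Sphere d)) [IsProbabilityMeasure ρ]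
    (m : ℕ → ℕ) (hm : ∀ n, 0 < m n)
    (nu : ℕ → ℝ) (hnu : ∀ n, 0 < nu n ∧ nu n ≤ 1)
    (eta : ℕ → ℝ) (heta_pos : ∀ n, 0 < eta n) (heta : eta =O[atTop] (fun _ => (1 : ℝ))) :
    Tendsto (fun n => ReluNet.sampleLaw ρ n (m n) (nu n)
        {z | 0 < 1 - eta n * ReluNet.minEigenvalue (ReluNet.kernelMatrix z.1 z.2.1 z.2.2)})
      atTop (𝓝 1) ∧
    ∀ ε : ℝ, 0 < ε →
      Tendsto (fun n => ReluNet.sampleLaw ρ n (m n) (nu n)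
          {z | ε ≤ |ReluNet.convergenceRate (eta n) z.1 z.2.1 z.2.2|})
        atTop (𝓝 0) := by
  have hnonneg : ∀ n (z : ReluNet.Sample d n (m n)),
      0 ≤ eta n * ReluNet.minEigenvalue (ReluNet.kernelMatrix z.1 z.2.1 z.2.2) := fun n z =>
    mul_nonneg (heta_pos n).le
      (ReluNet.minEigenvalue_nonneg (ReluNet.kernelMatrix_posSemidef _ _ _))
  constructor
  · refine tendsto_const_nhds.congr' ?_
    filter_upwards [ReluNet.eventually_forall_eta_mul_minEigenvalue_lt heta_pos heta d m
      one_pos] with n hn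
    rw [Set.eq_univ_of_forall (s := {z : ReluNet.Sample d n (m n) | 0 < 1 - eta n *
      ReluNet.minEigenvalue (ReluNet.kernelMatrix z.1 z.2.1 z.2.2)}) fun z => sub_pos.2 (hn z),
      measure_univ]
  · intro ε hε
    have hcont : ContinuousAt (fun t : ℝ => Real.log (1 / (1 - t))) 0 := by
      refine ContinuousAt.log ?_ (by norm_num)
      exact continuousAt_const.div (by fun_prop) (by norm_num)
    obtain ⟨δ, hδ, hclose⟩ := Metric.continuousAt_iff.1 hcont ε hε
    refine tendsto_const_nhds.congr' ?_
    filter_upwards [ReluNet.eventually_forall_eta_mul_minEigenvalue_lt heta_pos heta d m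
      hδ] with n hn
    rw [Set.eq_empty_of_forall_notMem (s := {z : ReluNet.Sample d n (m n) | ε ≤
      |ReluNet.convergenceRate (eta n) z.1 z.2.1 z.2.2|}) fun z hz => ?_, measure_empty]
    have h := hclose (x := eta n * ReluNet.minEigenvalue (ReluNet.kernelMatrix z.1 z.2.1 z.2.2))
      (by rw [Real.dist_0_eq_abs, abs_of_nonneg (hnonneg n z)]; exact hn z)
    rw [sub_zero, div_one, Real.log_one, Real.dist_0_eq_abs] at h
    exact (not_lt.2 hz) h
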